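/- Theorem 1.7. Let $G=(V,E)$ be a finite, connected, undirected graph without self-loops or multiple edges, with at least two vertices. Then the following three conditions are equivalent. (1) $G$ is a Laman graph: $|E| = 2|V|-3$, and $|E'| \le 2|V'|-3$ for every subgraph $G'=(V',E')$ of $G$ with $|V'|\ge 2$. (2) $G$ is generically rigid: there is a proper algebraic subset $Z \subsetneq \mathbb{C}^E$ (a set defined by polynomial equations) such that for every $\lambda \in \mathbb{C}^E\setminus Z$ the set of realizations $\rho\colon V\to\mathbb{C}^2$ with $$\lambda(\{u,v\}) = \langle \rho(u)-\rho(v),\, \rho(u)-\rho(v)\rangle \quad\text{for all } \{u,v\}\in E, \qquad \langle x,y\rangle = x_1y_1+x_2y_2,$$ is non-empty and consists of only finitely many classes up to equivalence. Here $\rho_1$ and $\rho_2$ are equivalent if $\rho_1=\sigma\circ\rho_2$ for a direct complex isometry $\sigma$, that is, a map $\sigma(x)=Ax+b$ with $b\in\mathbb{C}^2$ and $A\in\mathbb{C}^{2\times 2}$ satisfying $A^{T}A=I$ and $\det A=1$. (3) $G$ can be constructed, up to isomorphism, from the graph consisting of two vertices connected by an edge by iterating the following two Henneberg rules finitely many times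 (possibly zero times): (a) given two distinct vertices $u,v$ (adjacent or not), add a new vertex $t$ and the edges $\{u,t\}$, $\{v,t\}$; (b) given three distinct vertices $u,v,w$ such that $\{u,v\}$ is an edge, remove the edge $\{u,v\}$ and add a new vertex $t$ and the edges $\{u,t\}$, $\{v,t\}$, $\{w,t\}$. -/

import Mathlib

namespace LamanRigidity

open scoped Matrix

universe u

section Genericity

/-- A property `P` holds for a general point of the affine space `ℂ^σ` if the points where it fails
are contained in a proper algebraic subset, that is, in the common zero set, different from the
whole space, of some set `S` of polynomials. -/
def HoldsGenerally {σ : Type*} (P : (σ → ℂ) → Prop) : Prop :=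
  ∃ S : Set (MvPolynomial σ ℂ),
    {x : σ → ℂ | ∀ p ∈ S, MvPolynomial.eval x p = 0} ≠ Set.univ ∧
    {x : σ → ℂ | ¬ P x} ⊆ {x : σ → ℂ | ∀ p ∈ S, MvPolynomial.eval x p = 0}

end Genericity

section Realizations

variable {V : Type u}

/-- Complex labelings `λ : E → ℂ` of the edges of `G`. -/
abbrev Labeling (G : SimpleGraph V) : Type u := G.edgeSet → ℂ

/-- Complex realizations `ρ : V → ℂ²`. -/
abbrev Realization (V : Type u) : Type u := V → Fin 2 → ℂ

/-- `λ({a, b}) = ⟨ρ(a) - ρ(b), ρ(a) - ρ(b)⟩` for every edge `{a, b}`, where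
`⟨x, y⟩ = x₁ y₁ + x₂ y₂` is the (bilinear) dot product. -/
def Compatible (G : SimpleGraph V) (l : Labeling G) (ρ : Realization V) : Prop :=
  ∀ (a b : V) (h : G.Adj a b),
    l ⟨s(a, b), h⟩ = (ρ a - ρ b) ⬝ᵥ (ρ a - ρ b)

/-- A direct complex isometry of `ℂ²`: a map `x ↦ A x + c` with `A` a complex orthogonal matrix
(`Aᵀ A = 1`, no complex conjugation) of determinant `1`. -/
def IsDirectIsometry (f : (Fin 2 → ℂ) → (Fin 2 → ℂ)) : Prop :=
  ∃ (A : Matrix (Fin 2) (Fin 2) ℂ) (c : Fin 2 → ℂ),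
    Aᵀ * A = 1 ∧ A.det = 1 ∧ ∀ x, f x = A *ᵥ x + c

/-- Two realizations are equivalent if they differ by a direct complex isometry. -/
def Equivalent (ρ₁ ρ₂ : Realization V) : Prop :=
  ∃ f : (Fin 2 → ℂ) → (Fin 2 → ℂ), IsDirectIsometry f ∧ ρ₁ = f ∘ ρ₂

theorem Equivalent.refl (ρ : Realization V) : Equivalent ρ ρ :=
  ⟨id, ⟨1, 0, by simp, by simp, by simp⟩, rfl⟩

theorem Equivalent.symm {ρ₁ ρ₂ : Realization V} (h : Equivalent ρ₁ ρ₂) : Equivalent ρ₂ ρ₁ := by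
  obtain ⟨f, ⟨A, c, hA, hd, hf⟩, rfl⟩ := h
  have hA' : A * Aᵀ = 1 := mul_eq_one_comm.mp hA
  refine ⟨fun x => Aᵀ *ᵥ x + -(Aᵀ *ᵥ c), ⟨Aᵀ, -(Aᵀ *ᵥ c), by simpa using hA',
    by simpa using hd, fun _ => rfl⟩, ?_⟩
  funext a
  simp only [Function.comp_apply, hf, Matrix.mulVec_add, Matrix.mulVec_mulVec, hA,
    Matrix.one_mulVec, add_neg_cancel_right]

theorem Equivalent.trans {ρ₁ ρ₂ ρ₃ : Realization V} (h : Equivalent ρ₁ ρ₂)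
    (h' : Equivalent ρ₂ ρ₃) : Equivalent ρ₁ ρ₃ := by
  obtain ⟨f, ⟨A, c, hA, hd, hf⟩, rfl⟩ := h
  obtain ⟨g, ⟨B, d, hB, he, hg⟩, rfl⟩ := h'
  refine ⟨f ∘ g, ⟨A * B, A *ᵥ d + c, ?_, by simp [hd, he], fun x => ?_⟩, rfl⟩
  · rw [Matrix.transpose_mul, Matrix.mul_assoc, ← Matrix.mul_assoc Aᵀ, hA, Matrix.one_mul, hB]
  · simp only [Function.comp_apply, hf, hg, Matrix.mulVec_add, Matrix.mulVec_mulVec, add_assoc]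

/-- Equivalence as an equivalence relation on the realizations compatible with `l`. -/
def equivalence (G : SimpleGraph V) (l : Labeling G) :
    Setoid {ρ : Realization V // Compatible G l ρ} where
  r ρ₁ ρ₂ := Equivalent ρ₁.1 ρ₂.1
  iseqv := ⟨fun ρ => Equivalent.refl ρ.1, Equivalent.symm, Equivalent.trans⟩

/-- `(G, l)` is realizable if some realization is compatible with `l`. -/
def Realizable (G : SimpleGraph V) (l : Labeling G) : Prop :=
  ∃ ρ : Realization V, Compatible G l ρ

/-- `(G, l)` is rigid if it is realizable and has only finitely many compatible realizations up to
equivalence. -/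
def Rigid (G : SimpleGraph V) (l : Labeling G) : Prop :=
  Realizable G l ∧ Finite (Quotient (equivalence G l))

/-- `(G, l)` is rigid for a general labeling `l`. -/
def GenericallyRigid (G : SimpleGraph V) : Prop :=
  HoldsGenerally fun l : Labeling G => Rigid G l

end Realizations

section Combinatorics

/-- A Laman graph: `|E| = 2|V| - 3`, and `|E'| ≤ 2|V'| - 3` for every subgraph with at least two
vertices (a subgraph with fewer than two vertices has no edges, and `2|V'| - 3` is negative). -/
def IsLaman {V : Type u} (G : SimpleGraph V) : Prop :=
  (G.edgeSet.ncard : ℤ) = 2 * (Nat.card V : ℤ) - 3 ∧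
  ∀ H : G.Subgraph, 2 ≤ H.verts.ncard →
    (H.edgeSet.ncard : ℤ) ≤ 2 * (H.verts.ncard : ℤ) - 3

/-- First Henneberg rule: add a vertex `t` (here `none`) and the edges `{a, t}`, `{b, t}`. -/
def hennebergOne {V : Type u} (G : SimpleGraph V) (a b : V) : SimpleGraph (Option V) :=
  G.map Function.Embedding.some ⊔
    SimpleGraph.fromEdgeSet {s(some a, none), s(some b, none)}

/-- Second Henneberg rule: remove the edge `{a, b}`, add a vertex `t` (here `none`) and the edges
`{a, t}`, `{b, t}`, `{c, t}`. -/
def hennebergTwo {V : Type u} (G : SimpleGraph V) (a b c : V) : SimpleGraph (Option V) :=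
  (G.deleteEdges {s(a, b)}).map Function.Embedding.some ⊔
    SimpleGraph.fromEdgeSet {s(some a, none), s(some b, none), s(some c, none)}

/-- Graphs that are obtained, up to isomorphism, from the graph consisting of two vertices joined by
an edge by finitely many applications of the two Henneberg rules. -/
inductive HennebergConstructible : {V : Type u} → SimpleGraph V → Prop
  | edge {V : Type u} {G : SimpleGraph V} (e : G ≃g (⊤ : SimpleGraph (Fin 2))) :
      HennebergConstructible G
  | iso {V W : Type u} {G : SimpleGraph V} {H : SimpleGraph W} (e : G ≃g H)
      (hG : HennebergConstructible G) : HennebergConstructible H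
  | one {V : Type u} {G : SimpleGraph V} (hG : HennebergConstructible G) (a b : V)
      (hab : a ≠ b) : HennebergConstructible (hennebergOne G a b)
  | two {V : Type u} {G : SimpleGraph V} (hG : HennebergConstructible G) (a b c : V)
      (hab : G.Adj a b) (hca : c ≠ a) (hcb : c ≠ b) :
      HennebergConstructible (hennebergTwo G a b c)

end Combinatorics

end LamanRigidity

/-! ### General fibres of polynomial maps over an algebraically closed field. -/

section GenericFibres

open MvPolynomial

/-! The cycle is Laman ⇒ Henneberg ⇒ generically rigid ⇒ Laman; the two steps involving rigidity
pass through `LengthsIndependent`.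

Modulo direct isometries, a realization with a non-isotropic edge uv has a unique pinned form with
2|V| - 3 free coordinates, so the squared lengths become |E| polynomials in 2|V| - 3 variables.
Generic realizability makes them algebraically independent. Independence passes to subgraphs and
bounds their edge numbers; if |E| were less than 2|V| - 3, some general fibre would be infinite
(`AlgebraicIndependent.exists_fibre_infinite`). Conversely, 2|V| - 3 independent lengths form a
transcendence basis, so general fibres are non-empty and finite
(`IsTranscendenceBasis.exists_fibre_nonempty_finite`).

For Henneberg graphs, independence follows from a single realization at which the differential of
the lengths is surjective. Both moves preserve the existence of such a realization, after a
perturbation to general position.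

A Laman graph with at least three vertices has a vertex of degree 2 or 3. Removing it undoes a
Henneberg move; in degree 3, `LamanCount.exists_reducible_pair` finds the two neighbours to join. -/

theorem IsAlgClosed.exists_ringHom_comp_algebraMap_eq {A B k : Type*} [CommRing A] [CommRing B]
    [Algebra A B] [Algebra.IsIntegral A B] [Field k] [IsAlgClosed k]
    (hAB : Function.Injective (algebraMap A B)) (φ : A →+* k) (hφ : Function.Surjective φ) :
    ∃ ψ : B →+* k, ψ.comp (algebraMap A B) = φ := by
  have hker : (RingHom.ker φ).IsMaximal := RingHom.ker_isMaximal_of_surjective _ hφ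
  obtain ⟨m, hm, hmφ⟩ := Ideal.exists_ideal_over_maximal_of_isIntegral (S := B)
    (RingHom.ker φ) (by
      rw [(RingHom.injective_iff_ker_eq_bot _).mp hAB]
      exact bot_le)
  let q : A →+* B ⧸ m := (Ideal.Quotient.mk m).comp (algebraMap A B)
  have hq : RingHom.ker φ ≤ RingHom.ker q := by
    intro a ha
    rw [← hmφ, Ideal.mem_comap, ← Ideal.Quotient.eq_zero_iff_mem] at ha
    exact ha
  -- The residue field B/m is integral over k, hence equal to k; inverting `g` gives the extension.
  let g : k →+* B ⧸ m := RingHom.liftOfSurjective φ hφ ⟨q, hq⟩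
  have hg : g.comp φ = q := RingHom.liftOfRightInverse_comp _ _ _ _
  have hgint : g.IsIntegral := by
    refine RingHom.IsIntegral.tower_top φ _ ?_
    rw [hg]
    exact RingHom.IsIntegral.trans _ _ (algebraMap_isIntegral_iff.mpr inferInstance)
      (RingHom.isIntegral_of_surjective _ Ideal.Quotient.mk_surjective)
  let e := RingEquiv.ofBijective g (IsAlgClosed.ringHom_bijective_of_isIntegral g hgint)
  refine ⟨(e.symm : B ⧸ m →+* k).comp (Ideal.Quotient.mk m), ?_⟩
  ext a
  refine e.injective ?_
  simpa using! (RingHom.congr_fun hg a).symm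

/-- After inverting `c` the extension is integral. Instead of localizing, φ is extended to the
integral closure and powers of `φ c` are divided out. -/
theorem IsAlgClosed.exists_ringHom_comp_algebraMap_eq_of_pow_smul {A R k : Type*} [CommRing A]
    [CommRing R] [Algebra A R] [Field k] [IsAlgClosed k]
    (hAR : Function.Injective (algebraMap A R)) (φ : A →+* k) (hφ : Function.Surjective φ)
    {c : A} (hc : φ c ≠ 0) (h : ∀ b : R, ∃ n : ℕ, IsIntegral A (c ^ n • b)) :
    ∃ ψ : R →+* k, ψ.comp (algebraMap A R) = φ := by
  let B := integralClosure A R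
  obtain ⟨ψ, hψ⟩ := IsAlgClosed.exists_ringHom_comp_algebraMap_eq (A := A) (B := B)
    (fun a b h => hAR (congrArg (Subtype.val : B → R) h)) φ hφ
  have hψφ (a : A) (b : B) : ψ (a • b) = φ a * ψ b := by
    rw [Algebra.smul_def, map_mul, ← hψ]
    rfl
  choose n hn using h
  let θ : R → k := fun b => ψ ⟨c ^ n b • b, hn b⟩ / φ c ^ n b
  -- The value of θ does not depend on the exponent used to clear denominators.
  have hθ {b : R} {m : ℕ} (z : B) (hz : (z : R) = c ^ m • b) : θ b = ψ z / φ c ^ m := by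
    have h1 : c ^ m • (⟨c ^ n b • b, hn b⟩ : B) = c ^ n b • z := by
      apply Subtype.ext
      change c ^ m • (c ^ n b • b) = c ^ n b • (z : R)
      rw [hz, smul_comm]
    have h2 := congrArg ψ h1
    rw [hψφ, hψφ, map_pow, map_pow] at h2
    rw [div_eq_div_iff (pow_ne_zero _ hc) (pow_ne_zero _ hc), mul_comm, h2, mul_comm]
  have hθA (a : A) : θ (algebraMap A R a) = φ a := by
    rw [hθ (m := 0) (a • 1 : B) (by simp [Algebra.smul_def]), hψφ]
    simp
  refine ⟨{ toFun := θ, map_one' := ?_, map_mul' := ?_, map_zero' := ?_, map_add' := ?_ }, ?_⟩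
  · simpa using hθA 1
  · intro a b
    rw [hθ (m := n a + n b) (⟨c ^ n a • a, hn a⟩ * ⟨c ^ n b • b, hn b⟩ : B), map_mul]
    · simp only [θ]
      field_simp
      ring
    · change (c ^ n a • a) * (c ^ n b • b) = _
      rw [smul_mul_smul_comm, pow_add]
  · simpa using hθA 0
  · intro a b
    rw [hθ (m := n a + n b) (c ^ n b • ⟨c ^ n a • a, hn a⟩ + c ^ n a • ⟨c ^ n b • b, hn b⟩ : B),
      map_add, hψφ, hψφ]
    · simp only [θ, map_pow]
      field_simp
      ring
    · change c ^ n b • (c ^ n a • a) + c ^ n a • (c ^ n b • b) = _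
      rw [smul_smul, smul_smul, smul_add, pow_add, mul_comm]
  · ext a
    exact hθA a

/-- Every coordinate is algebraic over k[F], so a common denominator c makes them all integral.
Where c does not vanish, the map behaves like a finite one. -/
theorem IsTranscendenceBasis.exists_fibre_nonempty_finite {k I E : Type*} [Field k] [IsAlgClosed k]
    [Finite I] {F : E → MvPolynomial I k} (hF : IsTranscendenceBasis k F) :
    ∃ Q : MvPolynomial E k, Q ≠ 0 ∧ ∀ y : E → k, eval y Q ≠ 0 →
      {x : I → k | ∀ e, eval x (F e) = y e}.Nonempty ∧
      {x : I → k | ∀ e, eval x (F e) = y e}.Finite := by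
  classical
  have := Fintype.ofFinite I
  have hind := hF.1
  have halg := hF.isAlgebraic
  obtain ⟨c, hc0, hc⟩ := Algebra.IsAlgebraic.exists_integral_multiples
    (Algebra.adjoin k (Set.range F)) (Finset.univ.image (X : I → MvPolynomial I k))
  replace hc : ∀ i : I, IsIntegral (Algebra.adjoin k (Set.range F)) (c • (X i : MvPolynomial I k)) :=
    fun i => hc _ (by simp)
  -- Q is c written as a polynomial in the F's.
  refine ⟨hind.repr c, by simpa [AlgebraicIndependent.repr] using hc0, fun y hy => ?_⟩
  let φ : Algebra.adjoin k (Set.range F) →ₐ[k] k := (aeval y).comp hind.repr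
  have hφc : φ c ≠ 0 := hy
  have hφF (e : E) (h : F e ∈ Algebra.adjoin k (Set.range F)) : φ ⟨F e, h⟩ = y e := by
    have : hind.repr ⟨F e, h⟩ = X e := by
      apply hind
      rw [hind.aeval_repr, aeval_X]
    simp [φ, this]
  constructor
  · have hint (p : MvPolynomial I k) :
        ∃ n : ℕ, IsIntegral (Algebra.adjoin k (Set.range F)) (c ^ n • p) := by
      induction p using MvPolynomial.induction_on with
      | C a =>
        refine ⟨0, ?_⟩
        rw [pow_zero, one_smul]
        exact isIntegral_algebraMap (x := algebraMap k (Algebra.adjoin k (Set.range F)) a)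
      | add p q hp hq =>
        obtain ⟨m, hm⟩ := hp
        obtain ⟨n, hn⟩ := hq
        refine ⟨m + n, ?_⟩
        rw [smul_add]
        refine .add ?_ ?_
        · rw [add_comm, pow_add, mul_smul]
          exact hm.smul _
        · rw [pow_add, mul_smul]
          exact hn.smul _
      | mul_X p i hp =>
        obtain ⟨n, hn⟩ := hp
        refine ⟨n + 1, ?_⟩
        rw [pow_succ, ← smul_mul_smul_comm]
        exact hn.mul (hc i)
    obtain ⟨ψ, hψ⟩ := IsAlgClosed.exists_ringHom_comp_algebraMap_eq_of_pow_smul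
      (R := MvPolynomial I k) Subtype.val_injective
      (φ : Algebra.adjoin k (Set.range F) →+* k) (fun a => ⟨algebraMap _ _ a, by simp⟩) hφc hint
    have hev : ψ = eval fun i => ψ (X i) := by
      apply MvPolynomial.ringHom_ext
      · intro a
        rw [eval_C]
        have := RingHom.congr_fun hψ (algebraMap k _ a)
        rw [RingHom.coe_coe, φ.commutes] at this
        exact this
      · simp
    refine ⟨fun i => ψ (X i), fun e => ?_⟩
    rw [← hev, ← hφF e (Algebra.subset_adjoin ⟨e, rfl⟩)]
    exact RingHom.congr_fun hψ ⟨F e, _⟩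
  -- On the fibre, `φ c * x i` is a root of a monic polynomial specialized at y, so each coordinate
  -- takes finitely many values.
  · choose p hp hpc using hc
    refine (Set.Finite.pi' fun i => (((p i).map (φ : _ →+* k)).rootSet_finite k).preimage
      (f := fun t => φ c * t) fun a _ b _ h => mul_left_cancel₀ hφc h).subset fun x hx i => ?_
    have hx' (a : Algebra.adjoin k (Set.range F)) : eval x (a : MvPolynomial I k) = φ a := by
      rw [← hind.aeval_repr a, ← coe_aeval_eq_eval, RingHom.coe_coe, ← AlgHom.comp_apply,
        comp_aeval]
      simp only [φ, AlgHom.comp_apply]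
      exact congrArg (fun z => aeval z (hind.repr a)) (funext hx)
    rw [Set.mem_preimage, Polynomial.mem_rootSet_of_ne ((hp i).map _).ne_zero]
    have h2 := Polynomial.hom_eval₂ (p i) (algebraMap _ (MvPolynomial I k)) (eval x) (c • X i)
    rw [hpc i, map_zero] at h2
    have h3 : (eval x).comp (algebraMap (Algebra.adjoin k (Set.range F)) (MvPolynomial I k)) =
        (φ : _ →+* k) := by
      ext a
      exact hx' a
    have h4 : eval x (c • X i) = φ c * x i := by
      rw [Algebra.smul_def, map_mul, eval_X, ← RingHom.comp_apply, h3]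
      rfl
    rw [h3, h4] at h2
    rw [Polynomial.aeval_def, Polynomial.eval₂_map]
    exact h2.symm

theorem AlgebraicIndependent.card_le {k I E : Type*} [Field k]
    [Finite I] {F : E → MvPolynomial I k} (hF : AlgebraicIndependent k F) :
    Finite E ∧ Nat.card E ≤ Nat.card I := by
  have h := hF.lift_cardinalMk_le_trdeg
  rw [MvPolynomial.trdeg_of_isDomain] at h
  have hE : Finite E := by
    rw [← Cardinal.mk_lt_aleph0_iff, ← Cardinal.lift_lt_aleph0]
    exact h.trans_lt (by simp)
  refine ⟨hE, ?_⟩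
  have := Fintype.ofFinite I
  have := Fintype.ofFinite E
  simpa using h

theorem AlgebraicIndependent.isTranscendenceBasis_of_card_le {k I E : Type*} [Field k]
    [Finite I] {F : E → MvPolynomial I k} (hF : AlgebraicIndependent k F)
    (hcard : Nat.card I ≤ Nat.card E) : IsTranscendenceBasis k F := by
  have := hF.card_le.1
  apply hF.isTranscendenceBasis_of_lift_trdeg_le_of_finite
  rw [MvPolynomial.trdeg_of_isDomain]
  have := Fintype.ofFinite I
  have := Fintype.ofFinite E
  simpa using hcard

/-- Extend F to a transcendence basis, which has at least one further member j. Fixing the other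
values and varying that of j gives infinitely many non-empty, disjoint pieces of one fibre of F. -/
theorem AlgebraicIndependent.exists_fibre_infinite {k I E : Type*} [Field k] [IsAlgClosed k]
    [Finite I] {F : E → MvPolynomial I k} (hF : AlgebraicIndependent k F)
    (hcard : Nat.card E < Nat.card I) {P : MvPolynomial E k} (hP : P ≠ 0) :
    ∃ y : E → k, eval y P ≠ 0 ∧ {x : I → k | ∀ e, eval x (F e) = y e}.Infinite := by
  classical
  have : Algebra.IsAlgebraic (Algebra.adjoin k (Set.univ : Set (MvPolynomial I k)))
      (MvPolynomial I k) :=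
    ⟨fun a => isAlgebraic_algebraMap
      (⟨a, Algebra.subset_adjoin trivial⟩ : Algebra.adjoin k (Set.univ : Set (MvPolynomial I k)))⟩
  obtain ⟨u, hFu, -, hu⟩ := exists_isTranscendenceBasis_between (R := k) (Set.range F) Set.univ
    (Set.subset_univ _) hF.to_subtype_range
  let ι : E → u := fun e => ⟨F e, hFu ⟨e, rfl⟩⟩
  have hι : Function.Injective ι := fun a b h => hF.injective (congrArg Subtype.val h)
  have hufin : Finite u := hu.1.card_le.1
  have hEfin : Finite E := hF.card_le.1
  have hucard : Nat.card u = Nat.card I := by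
    have h := hu.lift_cardinalMk_eq (IsTranscendenceBasis.mvPolynomial I k)
    have := Fintype.ofFinite I
    have := Fintype.ofFinite u
    simpa using h
  obtain ⟨j, hj⟩ : ∃ j, j ∉ Set.range ι := by
    by_contra! h
    have := Nat.card_le_card_of_surjective ι h
    omega
  obtain ⟨Q, hQ, hfib⟩ := hu.exists_fibre_nonempty_finite
  have hne : Q * rename ι P ≠ 0 :=
    mul_ne_zero hQ fun h => hP (rename_injective ι hι (by simpa using h))
  have hkinf : Infinite k := IsAlgClosed.instInfinite
  obtain ⟨w, hw⟩ : ∃ w : u → k, eval w (Q * rename ι P) ≠ 0 := by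
    by_contra! h
    exact hne (MvPolynomial.funext fun x => by simp [h x])
  -- R is the restriction of Q · P to the line through w in direction j; it is nonzero at `w j`, so
  -- it has finitely many roots.
  let R : Polynomial k :=
    aeval (Function.update (fun i => Polynomial.C (w i)) j Polynomial.X) (Q * rename ι P)
  have hR (t : k) : R.eval t = eval (Function.update w j t) (Q * rename ι P) := by
    have : (Polynomial.evalRingHom t).comp
        (aeval (Function.update (fun i => Polynomial.C (w i)) j Polynomial.X) :
          MvPolynomial u k →ₐ[k] Polynomial k).toRingHom = eval (Function.update w j t) := by
      ext i
      · simp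
      · by_cases h : i = j
        · subst h; simp
        · simp [h]
    rw [← this]
    rfl
  have hR0 : R ≠ 0 := by
    intro h
    have := hR (w j)
    rw [h, Function.update_eq_self] at this
    exact hw (by simpa using this.symm)
  have hupd (t : k) : Function.update w j t ∘ ι = w ∘ ι := by
    funext e
    exact Function.update_of_ne (fun h => hj ⟨e, h⟩) _ _
  refine ⟨w ∘ ι, ?_, Set.Infinite.of_image (fun x => eval x (j : MvPolynomial I k)) ?_⟩
  · rw [map_mul, eval_rename] at hw
    exact right_ne_zero_of_mul hw
  · refine (Set.Finite.infinite_compl (Polynomial.finite_setOfPred_isRoot hR0)).mono fun t ht => ?_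
    have ht' : R.eval t ≠ 0 := ht
    rw [hR, map_mul] at ht'
    obtain ⟨x, hx⟩ := (hfib _ (left_ne_zero_of_mul ht')).1
    refine ⟨x, fun e => ?_, ?_⟩
    · have := hx (ι e)
      rw [← Function.comp_apply (f := Function.update w j t), hupd] at this
      exact this
    · simpa using hx j

end GenericFibres

namespace LamanRigidity

open scoped Matrix

universe u

open MvPolynomial

theorem holdsGenerally_iff {σ : Type*} {P : (σ → ℂ) → Prop} :
    HoldsGenerally P ↔ ∃ p : MvPolynomial σ ℂ, p ≠ 0 ∧ ∀ x, eval x p ≠ 0 → P x := by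
  constructor
  · rintro ⟨S, hS, hP⟩
    obtain ⟨x, hx⟩ := (Set.ne_univ_iff_exists_notMem _).mp hS
    simp only [Set.mem_ofPred_eq, not_forall] at hx
    obtain ⟨p, hp, hpx⟩ := hx
    refine ⟨p, fun h => hpx (by simp [h]), fun y hy => ?_⟩
    by_contra h
    exact hy (hP h p hp)
  · rintro ⟨p, hp, h⟩
    refine ⟨{p}, fun hu => hp (MvPolynomial.funext fun x => ?_), fun x hx q hq => ?_⟩
    · simpa using (Set.eq_univ_iff_forall.mp hu x) p rfl
    · rw [Set.mem_singleton_iff.mp hq]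
      by_contra hne
      exact hx (h x hne)

/-! ### Squared lengths and their polynomial relations. -/

section Lengths

variable {V : Type u}

/-- The squared edge lengths of a realization. -/
def lengths (G : SimpleGraph V) (ρ : Realization V) : Labeling G := fun e =>
  Sym2.lift ⟨fun a b => (ρ a - ρ b) ⬝ᵥ (ρ a - ρ b), fun a b => by
    change (ρ a - ρ b) ⬝ᵥ (ρ a - ρ b) = (ρ b - ρ a) ⬝ᵥ (ρ b - ρ a)
    rw [← neg_sub (ρ b) (ρ a), neg_dotProduct_neg]⟩ e.1

theorem compatible_iff {G : SimpleGraph V} {l : Labeling G} {ρ : Realization V} :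
    Compatible G l ρ ↔ lengths G ρ = l := by
  constructor
  · rintro h
    funext ⟨e, he⟩
    induction e with
    | _ a b => exact (h a b he).symm
  · rintro rfl a b h
    rfl

theorem Equivalent.lengths_eq {ρ₁ ρ₂ : Realization V} (h : Equivalent ρ₁ ρ₂) (G : SimpleGraph V) :
    lengths G ρ₁ = lengths G ρ₂ := by
  obtain ⟨f, ⟨A, c, hA, -, hf⟩, rfl⟩ := h
  rw [← compatible_iff]
  intro a b hab
  have h1 : f (ρ₂ a) - f (ρ₂ b) = A *ᵥ (ρ₂ a - ρ₂ b) := by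
    rw [hf, hf, Matrix.mulVec_sub]
    abel
  simp only [Function.comp_apply, h1]
  rw [Matrix.dotProduct_mulVec, Matrix.vecMul_mulVec, hA, Matrix.vecMul_one]
  rfl

/-- The squared edge lengths satisfy no polynomial relation. -/
def LengthsIndependent (G : SimpleGraph V) : Prop :=
  ∀ P : MvPolynomial G.edgeSet ℂ, (∀ ρ, eval (lengths G ρ) P = 0) → P = 0

/-- A relation P would vanish at every realizable labeling, so Q · P would vanish everywhere, where
Q cuts out the exceptional set. -/
theorem GenericallyRigid.lengthsIndependent {G : SimpleGraph V} (h : GenericallyRigid G) :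
    LengthsIndependent G := by
  obtain ⟨Q, hQ, hrigid⟩ := holdsGenerally_iff.mp h
  intro P hP
  by_contra hP0
  refine mul_ne_zero hQ hP0 (MvPolynomial.funext fun l => ?_)
  rw [map_mul, map_zero]
  by_cases hl : eval l Q = 0
  · rw [hl, zero_mul]
  · obtain ⟨ρ, hρ⟩ := (hrigid l hl).1
    rw [← compatible_iff.mp hρ, hP, mul_zero]

theorem LengthsIndependent.coe {G : SimpleGraph V} (h : LengthsIndependent G) (H : G.Subgraph) :
    LengthsIndependent H.coe := by
  classical
  intro P hP
  let ι : H.coe.edgeSet → G.edgeSet := H.hom.mapEdgeSet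
  have hι : Function.Injective ι := SimpleGraph.Hom.mapEdgeSet.injective _ H.hom_injective
  refine rename_injective ι hι ?_
  rw [map_zero]
  refine h _ fun ρ => ?_
  rw [eval_rename]
  convert hP fun w => ρ w
  funext ⟨e, he⟩
  induction e with
  | _ a b => rfl

end Lengths

/-! ### Normal forms modulo direct isometries, and edge counts. -/

section Pinned

variable {V : Type u}

/-- The coordinates that remain free once `u` is placed at the origin and the first isotropic
coordinate of `v` is normalised to `1`. -/
abbrev FreeCoord (u v : V) : Type u := {i : V × Fin 2 // i.1 ≠ u ∧ i ≠ (v, 0)}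

theorem card_freeCoord [Finite V] {u v : V} (huv : u ≠ v) :
    (Nat.card (FreeCoord u v) : ℤ) = 2 * (Nat.card V : ℤ) - 3 := by
  classical
  have := Fintype.ofFinite V
  have h : Fintype.card {i : V × Fin 2 // ¬ (i.1 ≠ u ∧ i ≠ (v, 0))} = 3 := by
    rw [Fintype.card_subtype]
    have : (Finset.univ.filter fun i : V × Fin 2 => ¬ (i.1 ≠ u ∧ i ≠ (v, 0))) =
        {(u, 0), (u, 1), (v, 0)} := by
      ext ⟨w, k⟩
      fin_cases k <;> simp [imp_iff_not_or]
    rw [this]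
    simp [huv]
  have h2 := Fintype.card_subtype_compl (fun i : V × Fin 2 => i.1 ≠ u ∧ i ≠ (v, 0))
  have h3 := Fintype.card_subtype_le (fun i : V × Fin 2 => i.1 ≠ u ∧ i ≠ (v, 0))
  have h4 := Fintype.card_subtype_le fun i : V × Fin 2 => ¬ (i.1 ≠ u ∧ i ≠ (v, 0))
  rw [h] at h2 h4
  simp only [Fintype.card_prod, Fintype.card_fin] at h2 h3 h4
  have h5 : Nat.card (FreeCoord u v) = Fintype.card {i : V × Fin 2 // i.1 ≠ u ∧ i ≠ (v, 0)} :=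
    Nat.card_eq_fintype_card
  rw [h5, Nat.card_eq_fintype_card]
  omega

open Classical in
/-- The isotropic coordinates of a pinned realization. -/
noncomputable def pinnedCoord (u v w : V) (k : Fin 2) : MvPolynomial (FreeCoord u v) ℂ :=
  if h : w ≠ u ∧ (w, k) ≠ (v, 0) then X ⟨(w, k), h⟩ else if w = u then 0 else 1

/-- The squared edge lengths of a pinned realization, as polynomials in the free coordinates. -/
noncomputable def pinnedLength (G : SimpleGraph V) (u v : V) (e : G.edgeSet) :
    MvPolynomial (FreeCoord u v) ℂ :=
  Sym2.lift ⟨fun a b => (pinnedCoord u v a 0 - pinnedCoord u v b 0) *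
    (pinnedCoord u v a 1 - pinnedCoord u v b 1), fun a b => by ring⟩ e.1

/-- The point of `ℂ²` with given isotropic coordinates `x₁ + i x₂` and `x₁ - i x₂`. -/
noncomputable def ofIsotropic (p q : ℂ) : Fin 2 → ℂ :=
  ![(p + q) / 2, -Complex.I * (p - q) / 2]

/-- The pinned realization with given free coordinates. -/
noncomputable def pinned (u v : V) (x : FreeCoord u v → ℂ) : Realization V := fun w =>
  ofIsotropic (eval x (pinnedCoord u v w 0)) (eval x (pinnedCoord u v w 1))

theorem lengths_pinned (G : SimpleGraph V) (u v : V) (x : FreeCoord u v → ℂ) :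
    lengths G (pinned u v x) = fun e => eval x (pinnedLength G u v e) := by
  funext ⟨e, he⟩
  induction e with
  | _ a b =>
    simp only [lengths, pinnedLength, Sym2.lift_mk, pinned, ofIsotropic, map_mul, map_sub,
      dotProduct, Fin.sum_univ_two, Pi.sub_apply, Matrix.cons_val_zero, Matrix.cons_val_one]
    generalize eval x (pinnedCoord u v a 0) = p
    generalize eval x (pinnedCoord u v b 0) = q
    generalize eval x (pinnedCoord u v a 1) = r
    generalize eval x (pinnedCoord u v b 1) = s
    linear_combination ((p - q) - (r - s)) ^ 2 / 4 * Complex.I_sq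

theorem isDirectIsometry_of_sq_add_sq_eq_one {c s : ℂ} (h : c ^ 2 + s ^ 2 = 1) (a b : ℂ) :
    IsDirectIsometry fun x => ![c * x 0 - s * x 1 + a, s * x 0 + c * x 1 + b] := by
  refine ⟨!![c, -s; s, c], ![a, b], ?_, ?_, fun x => ?_⟩
  · ext i j
    fin_cases i <;> fin_cases j <;> simp [Matrix.mul_apply, Fin.sum_univ_two] <;> first | ring1 |
      linear_combination h
  · rw [Matrix.det_fin_two_of]
    linear_combination h
  · ext i
    fin_cases i <;> simp [dotProduct, Fin.sum_univ_two] <;> ring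

theorem IsDirectIsometry.exists_eq {f : (Fin 2 → ℂ) → Fin 2 → ℂ} (hf : IsDirectIsometry f) :
    ∃ c s a b : ℂ, c ^ 2 + s ^ 2 = 1 ∧
      f = fun x => ![c * x 0 - s * x 1 + a, s * x 0 + c * x 1 + b] := by
  obtain ⟨A, t, hA, hd, hf⟩ := hf
  have hadj : Aᵀ = A.adjugate := by
    rw [← Matrix.mul_one A.adjugate, ← mul_eq_one_comm.mp hA, ← Matrix.mul_assoc,
      Matrix.adjugate_mul, hd, one_smul, Matrix.one_mul]
  rw [Matrix.adjugate_fin_two] at hadj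
  have h00 := congrFun (congrFun hadj 0) 0
  have h01 := congrFun (congrFun hadj 1) 0
  simp only [Matrix.transpose_apply, Matrix.of_apply, Matrix.cons_val', Matrix.cons_val_zero,
    Matrix.cons_val_one, Matrix.cons_val_fin_one] at h00 h01
  rw [Matrix.det_fin_two] at hd
  refine ⟨A 0 0, A 1 0, t 0, t 1, ?_, ?_⟩
  · linear_combination hd + A 0 0 * h00 + A 1 0 * h01
  · funext x
    rw [hf]
    ext i
    fin_cases i
    · simp [h01]
      ring
    · simp [h00]

/-- The isotropic coordinates `x₁ + i x₂` and `x₁ - i x₂` of a point of `ℂ²`. -/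
noncomputable def isotropic (x : Fin 2 → ℂ) (k : Fin 2) : ℂ :=
  ![x 0 + Complex.I * x 1, x 0 - Complex.I * x 1] k

theorem isotropic_ofIsotropic (p q : ℂ) : isotropic (ofIsotropic p q) = ![p, q] := by
  funext k
  fin_cases k <;> simp [isotropic, ofIsotropic]
  · linear_combination -(p - q) / 2 * Complex.I_sq
  · linear_combination (p - q) / 2 * Complex.I_sq

theorem ofIsotropic_isotropic (x : Fin 2 → ℂ) :
    ofIsotropic (isotropic x 0) (isotropic x 1) = x := by
  funext k
  fin_cases k <;> simp [isotropic, ofIsotropic]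
  linear_combination -x 1 * Complex.I_sq

theorem isotropic_pinned (u v : V) (x : FreeCoord u v → ℂ) (w : V) (k : Fin 2) :
    isotropic (pinned u v x w) k = eval x (pinnedCoord u v w k) := by
  rw [pinned, isotropic_ofIsotropic]
  fin_cases k <;> rfl

/-- In isotropic coordinates a rotation is (z, w) ↦ (ζz, ζ⁻¹w). Fixing u kills the translation, and
z(v) = 1 forces ζ = 1, with no leftover sign. -/
theorem pinned_injective {u v : V} (huv : u ≠ v) {x y : FreeCoord u v → ℂ}
    (h : Equivalent (pinned u v x) (pinned u v y)) : x = y := by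
  obtain ⟨f, hf, hxy⟩ := h
  obtain ⟨c, s, a, b, hcs, rfl⟩ := hf.exists_eq
  have hz (w : V) : eval x (pinnedCoord u v w 0) =
      (c + Complex.I * s) * eval y (pinnedCoord u v w 0) + (a + Complex.I * b) := by
    rw [← isotropic_pinned, ← isotropic_pinned, hxy]
    simp only [isotropic, Function.comp_apply, Matrix.cons_val_zero, Matrix.cons_val_one]
    linear_combination -(s * pinned u v y w 1) * Complex.I_sq
  have hw (w : V) : eval x (pinnedCoord u v w 1) =
      (c - Complex.I * s) * eval y (pinnedCoord u v w 1) + (a - Complex.I * b) := by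
    rw [← isotropic_pinned, ← isotropic_pinned, hxy]
    simp only [isotropic, Function.comp_apply, Matrix.cons_val_zero, Matrix.cons_val_one]
    linear_combination -(s * pinned u v y w 1) * Complex.I_sq
  have h1 : a + Complex.I * b = 0 := by simpa [pinnedCoord] using (hz u).symm
  have h2 : a - Complex.I * b = 0 := by simpa [pinnedCoord] using (hw u).symm
  have h3 : c + Complex.I * s = 1 := by simpa [pinnedCoord, huv.symm, h1] using (hz v).symm
  have h4 : c - Complex.I * s = 1 := by
    linear_combination hcs - s ^ 2 * Complex.I_sq - (c - Complex.I * s) * h3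
  funext ⟨⟨w, k⟩, hwk⟩
  have h5 : eval x (pinnedCoord u v w k) = eval y (pinnedCoord u v w k) := by
    fin_cases k
    · simpa [h1, h3] using hz w
    · simpa [h2, h4] using hw w
  simpa only [pinnedCoord, dif_pos hwk, eval_X] using h5

theorem exists_equivalent_pinned {u v : V} {ρ : Realization V}
    (h : (ρ u - ρ v) ⬝ᵥ (ρ u - ρ v) ≠ 0) :
    ∃ x : FreeCoord u v → ℂ, Equivalent (pinned u v x) ρ := by
  set z := isotropic (ρ v - ρ u) 0 with hz
  have hz0 : z ≠ 0 := by
    intro h0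
    refine h ?_
    simp only [isotropic, Matrix.cons_val_zero, Pi.sub_apply] at hz
    simp only [dotProduct, Fin.sum_univ_two, Pi.sub_apply]
    rw [h0] at hz
    linear_combination -((ρ v 0 - ρ u 0) - Complex.I * (ρ v 1 - ρ u 1)) * hz +
      (ρ v 1 - ρ u 1) ^ 2 * Complex.I_sq
  -- Chosen so that c + is = z⁻¹ and c - is = z: the rotation scales the first isotropic coordinate
  -- of `ρ v - ρ u` to 1.
  let c := (z⁻¹ + z) / 2
  let s := -Complex.I * (z⁻¹ - z) / 2
  have hcs : c ^ 2 + s ^ 2 = 1 := by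
    have := mul_inv_cancel₀ hz0
    simp only [c, s]
    linear_combination this + (z⁻¹ - z) ^ 2 / 4 * Complex.I_sq
  let f : (Fin 2 → ℂ) → Fin 2 → ℂ := fun x => ![c * x 0 - s * x 1 + -(c * ρ u 0 - s * ρ u 1),
    s * x 0 + c * x 1 + -(s * ρ u 0 + c * ρ u 1)]
  have hfu : f (ρ u) = 0 := by
    funext k
    fin_cases k <;> simp [f]
  have hfv : isotropic (f (ρ v)) 0 = 1 := by
    have h1 : (c + Complex.I * s) = z⁻¹ := by
      simp only [c, s]
      linear_combination -(z⁻¹ - z) / 2 * Complex.I_sq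
    have h2 : isotropic (f (ρ v)) 0 = (c + Complex.I * s) * z := by
      rw [hz]
      simp [isotropic, f]
      linear_combination -s * (ρ v 1 - ρ u 1) * Complex.I_sq
    rw [h2, h1, inv_mul_cancel₀ hz0]
  refine ⟨fun i => isotropic (f (ρ i.1.1)) i.1.2, f,
    isDirectIsometry_of_sq_add_sq_eq_one hcs _ _, ?_⟩
  have key (w : V) (k : Fin 2) : eval (fun i : FreeCoord u v => isotropic (f (ρ i.1.1)) i.1.2)
      (pinnedCoord u v w k) = isotropic (f (ρ w)) k := by
    by_cases hwk : w ≠ u ∧ (w, k) ≠ (v, 0)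
    · rw [pinnedCoord, dif_pos hwk, eval_X]
    · rw [pinnedCoord, dif_neg hwk]
      by_cases hwu : w = u
      · subst hwu
        rw [if_pos rfl, hfu]
        fin_cases k <;> simp [isotropic]
      · obtain ⟨rfl, rfl⟩ : w = v ∧ k = 0 := by simpa [hwu] using hwk
        rw [if_neg hwu, hfv, map_one]
  funext w
  rw [pinned, key, key, ofIsotropic_isotropic]
  rfl

theorem LengthsIndependent.algebraicIndependent {G : SimpleGraph V} (h : LengthsIndependent G)
    {u v : V} (huv : G.Adj u v) : AlgebraicIndependent ℂ (pinnedLength G u v) := by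
  rw [algebraicIndependent_iff]
  intro P hP
  -- The extra variable handles realizations with uv isotropic, which may have no pinned form.
  have h0 : X ⟨s(u, v), huv⟩ * P = 0 := by
    refine h _ fun ρ => ?_
    rw [map_mul, eval_X]
    by_cases h0 : lengths G ρ ⟨s(u, v), huv⟩ = 0
    · rw [h0, zero_mul]
    · obtain ⟨x, hx⟩ := exists_equivalent_pinned (u := u) (v := v) (ρ := ρ) h0
      have h1 := congrArg (eval x) hP
      rw [← hx.lengths_eq G, lengths_pinned]
      rw [← coe_aeval_eq_eval, RingHom.coe_coe, ← AlgHom.comp_apply, comp_aeval, map_zero] at h1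
      have h2 : eval (fun e => eval x (pinnedLength G u v e)) P = 0 := h1
      rw [h2, mul_zero]
  exact (mul_eq_zero.mp h0).resolve_left (X_ne_zero _)

theorem LengthsIndependent.card_edgeSet_le [Finite V] {G : SimpleGraph V}
    (h : LengthsIndependent G) {u v : V} (huv : G.Adj u v) :
    (Nat.card G.edgeSet : ℤ) ≤ 2 * (Nat.card V : ℤ) - 3 := by
  rw [← card_freeCoord huv.ne]
  exact_mod_cast (h.algebraicIndependent huv).card_le.2

theorem GenericallyRigid.card_edgeSet [Finite V] {G : SimpleGraph V} (h : GenericallyRigid G)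
    {u v : V} (huv : G.Adj u v) : (Nat.card G.edgeSet : ℤ) = 2 * (Nat.card V : ℤ) - 3 := by
  have hind := h.lengthsIndependent
  refine le_antisymm (hind.card_edgeSet_le huv) ?_
  rw [← card_freeCoord huv.ne, Nat.cast_le]
  by_contra! hlt
  obtain ⟨Q, hQ, hrigid⟩ := holdsGenerally_iff.mp h
  obtain ⟨l, hl, hinf⟩ := (hind.algebraicIndependent huv).exists_fibre_infinite hlt hQ
  have hfin := (hrigid l hl).2
  have hcomp (x : {x | ∀ e, eval x (pinnedLength G u v e) = l e}) :
      Compatible G l (pinned u v x) := by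
    rw [compatible_iff, lengths_pinned]
    exact funext x.2
  have := Finite.of_injective (fun x : {x | ∀ e, eval x (pinnedLength G u v e) = l e} =>
    (Quotient.mk (equivalence G l) ⟨pinned u v x, hcomp x⟩)) fun x y hxy =>
      Subtype.ext (pinned_injective huv.ne (Quotient.exact hxy))
  exact hinf (Set.toFinite _)

theorem LengthsIndependent.genericallyRigid [Finite V] {G : SimpleGraph V}
    (h : LengthsIndependent G) {u v : V} (huv : G.Adj u v)
    (hcard : (Nat.card G.edgeSet : ℤ) = 2 * (Nat.card V : ℤ) - 3) : GenericallyRigid G := by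
  rw [← card_freeCoord huv.ne, Nat.cast_inj] at hcard
  have hind := h.algebraicIndependent huv
  obtain ⟨Q, hQ, hfib⟩ :=
    (hind.isTranscendenceBasis_of_card_le hcard.ge).exists_fibre_nonempty_finite
  refine holdsGenerally_iff.mpr ⟨X ⟨s(u, v), huv⟩ * Q, mul_ne_zero (X_ne_zero _) hQ,
    fun l hl => ?_⟩
  rw [map_mul, eval_X] at hl
  obtain ⟨⟨x, hx⟩, hfin⟩ := hfib l (right_ne_zero_of_mul hl)
  have hcomp (x : {x | ∀ e, eval x (pinnedLength G u v e) = l e}) :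
      Compatible G l (pinned u v x) := by
    rw [compatible_iff, lengths_pinned]
    exact funext x.2
  refine ⟨⟨_, hcomp ⟨x, hx⟩⟩, ?_⟩
  have := hfin.to_subtype
  refine Finite.of_surjective (fun x : {x | ∀ e, eval x (pinnedLength G u v e) = l e} =>
    (Quotient.mk (equivalence G l) ⟨pinned u v x, hcomp x⟩)) fun q => ?_
  induction q using Quotient.ind with
  | _ ρ =>
    obtain ⟨ρ, hρ⟩ := ρ
    obtain ⟨x, hx⟩ := exists_equivalent_pinned (u := u) (v := v) (ρ := ρ)
      (by rw [← hρ u v huv]; exact left_ne_zero_of_mul hl)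
    refine ⟨⟨x, fun e => ?_⟩, Quotient.sound hx⟩
    rw [← congrFun (lengths_pinned G u v x) e, hx.lengths_eq, compatible_iff.mp hρ]

theorem GenericallyRigid.isLaman [Finite V] {G : SimpleGraph V} (h : GenericallyRigid G)
    (hne : ∃ u v, G.Adj u v) : IsLaman G := by
  obtain ⟨u, v, huv⟩ := hne
  refine ⟨h.card_edgeSet huv, fun H hH => ?_⟩
  by_cases hadj : ∃ a b, H.coe.Adj a b
  · obtain ⟨a, b, hab⟩ := hadj
    have h1 := (h.lengthsIndependent.coe H).card_edgeSet_le hab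
    have h2 : H.edgeSet.ncard = Nat.card H.coe.edgeSet := by
      rw [← SimpleGraph.Subgraph.image_coe_edgeSet_coe, Set.ncard_image_of_injective _
        (Sym2.map.injective Subtype.val_injective)]
      rfl
    rw [h2]
    exact h1
  · have : H.edgeSet = ∅ := by
      rw [Set.eq_empty_iff_forall_notMem]
      intro e he
      induction e with
      | _ a b => exact hadj ⟨⟨a, H.edge_vert he⟩, ⟨b, H.edge_vert (H.adj_symm he)⟩, he⟩
    rw [this, Set.ncard_empty]
    omega

end Pinned

/-! ### Infinitesimal rigidity: frameworks without self-stress. -/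

theorem eq_zero_of_eventually_eval_eq_zero {σ : Type*} [Fintype σ] {p : MvPolynomial σ ℂ}
    {x : σ → ℂ} (h : ∀ᶠ y in nhds x, eval y p = 0) : p = 0 := by
  obtain ⟨r, hr, hball⟩ := Metric.eventually_nhds_iff_ball.mp h
  refine MvPolynomial.funext_set (fun i => Metric.ball (x i) r)
    (fun i => infinite_of_mem_nhds (x i) (Metric.ball_mem_nhds _ hr)) fun y hy => ?_
  rw [map_zero]
  refine hball y ?_
  rw [ball_pi _ hr]
  exact hy

section RigidityMap

variable {V : Type u}

/-- The bilinear map underlying the squared edge lengths. Its value at `ρ` is the rigidity matrix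
of the framework `(G, ρ)`. -/
noncomputable def rigidityMap (G : SimpleGraph V) :
    Realization V →ₗ[ℂ] Realization V →ₗ[ℂ] Labeling G :=
  LinearMap.mk₂ ℂ (fun ρ p e => Sym2.lift ⟨fun a b => (ρ a - ρ b) ⬝ᵥ (p a - p b), fun a b => by
      change (ρ a - ρ b) ⬝ᵥ (p a - p b) = (ρ b - ρ a) ⬝ᵥ (p b - p a)
      rw [← neg_sub (ρ b) (ρ a), ← neg_sub (p b) (p a), neg_dotProduct_neg]⟩ e.1)
    (fun ρ₁ ρ₂ p => by
      funext ⟨e, he⟩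
      induction e with
      | _ a b => simp only [Sym2.lift_mk, Pi.add_apply, add_sub_add_comm, add_dotProduct])
    (fun c ρ p => by
      funext ⟨e, he⟩
      induction e with
      | _ a b => simp only [Sym2.lift_mk, Pi.smul_apply, ← smul_sub, smul_dotProduct])
    (fun ρ p₁ p₂ => by
      funext ⟨e, he⟩
      induction e with
      | _ a b => simp only [Sym2.lift_mk, Pi.add_apply, add_sub_add_comm, dotProduct_add])
    (fun c ρ p => by
      funext ⟨e, he⟩
      induction e with
      | _ a b => simp only [Sym2.lift_mk, Pi.smul_apply, ← smul_sub, dotProduct_smul])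

theorem rigidityMap_apply {G : SimpleGraph V} (ρ p : Realization V) {a b : V} (h : G.Adj a b) :
    rigidityMap G ρ p ⟨s(a, b), h⟩ = (ρ a - ρ b) ⬝ᵥ (p a - p b) := rfl

theorem rigidityMap_comm (G : SimpleGraph V) (ρ p : Realization V) :
    rigidityMap G ρ p = rigidityMap G p ρ := by
  funext ⟨e, he⟩
  induction e with
  | _ a b => exact dotProduct_comm (ρ a - ρ b) (p a - p b)

/-- The framework `(G, ρ)` has no self-stress: the differential of the squared edge lengths at `ρ`
is surjective. -/
def StressFree (G : SimpleGraph V) (ρ : Realization V) : Prop :=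
  Function.Surjective (rigidityMap G ρ)

theorem stressFree_iff {G : SimpleGraph V} {ρ : Realization V} :
    StressFree G ρ ↔ ∀ y : V → V → ℂ, (∀ a b, y a b = y b a) →
      ∃ p : Realization V, ∀ a b, G.Adj a b → (ρ a - ρ b) ⬝ᵥ (p a - p b) = y a b := by
  classical
  constructor
  · intro h y hy
    obtain ⟨p, hp⟩ := h fun e => Sym2.lift ⟨y, hy⟩ e.1
    exact ⟨p, fun a b hab => congrFun hp ⟨s(a, b), hab⟩⟩
  · intro h l
    obtain ⟨p, hp⟩ := h (fun a b => if hab : s(a, b) ∈ G.edgeSet then l ⟨s(a, b), hab⟩ else 0)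
      fun a b => by simp only [Sym2.eq_swap]
    refine ⟨p, ?_⟩
    funext ⟨e, he⟩
    induction e with
    | _ a b =>
      rw [rigidityMap_apply _ _ he, hp a b he, dif_pos he]

/-- By the open mapping property of a strict derivative that is onto, the lengths fill a
neighbourhood, and a polynomial vanishing there is zero. -/
theorem StressFree.lengthsIndependent [Finite V] {G : SimpleGraph V} {ρ : Realization V}
    (h : StressFree G ρ) : LengthsIndependent G := by
  have := Fintype.ofFinite V
  have := Fintype.ofFinite G.edgeSet
  intro P hP
  have hderiv : HasStrictFDerivAt (lengths G)
      ((2 : ℂ) • (rigidityMap G).toContinuousBilinearMap ρ) ρ := by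
    have := (rigidityMap G).toContinuousBilinearMap.hasStrictFDerivAt_of_bilinear
      (hasStrictFDerivAt_id ρ) (hasStrictFDerivAt_id ρ)
    convert! this using 1
    ext1 p
    have := rigidityMap_comm G ρ p
    simp [two_smul]
    exact this
  have hsurj : ((2 : ℂ) • (rigidityMap G).toContinuousBilinearMap ρ).range = ⊤ := by
    rw [LinearMap.range_eq_top]
    intro l
    obtain ⟨p, hp⟩ := h ((2 : ℂ)⁻¹ • l)
    refine ⟨p, ?_⟩
    simp [hp]
  refine eq_zero_of_eventually_eval_eq_zero (x := lengths G ρ) ?_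
  rw [← hderiv.map_nhds_eq_of_surj hsurj, Filter.eventually_map]
  exact Filter.Eventually.of_forall hP

/-- Surjectivity is an open condition, while the zero set of Q contains no open set. This supplies
the general position needed before each Henneberg move. -/
theorem StressFree.exists_eval_ne_zero [Finite V] {G : SimpleGraph V} {ρ : Realization V}
    (h : StressFree G ρ) {Q : MvPolynomial (V × Fin 2) ℂ} (hQ : Q ≠ 0) :
    ∃ ρ', StressFree G ρ' ∧ eval (fun i => ρ' i.1 i.2) Q ≠ 0 := by
  classical
  have := Fintype.ofFinite V
  have := Fintype.ofFinite G.edgeSet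
  by_contra! hcon
  obtain ⟨S, hS⟩ := LinearMap.exists_rightInverse_of_surjective _ (LinearMap.range_eq_top.mpr h)
  -- S is a right inverse at ρ, so D equals 1 there; wherever D ≠ 0 the rigidity map stays onto.
  let D : ((V × Fin 2) → ℂ) → ℂ := fun x =>
    (LinearMap.toMatrix' (rigidityMap G (fun a k => x (a, k)) ∘ₗ S)).det
  have hD : Continuous D := by
    refine Continuous.matrix_det (continuous_matrix fun e e' => ?_)
    have h1 : Continuous fun z : Realization V =>
        (rigidityMap G).toContinuousBilinearMap z (S (Pi.single e' 1)) e := by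
      fun_prop
    exact h1.comp (g := fun z : Realization V =>
        (rigidityMap G).toContinuousBilinearMap z (S (Pi.single e' 1)) e)
      (f := fun x : (V × Fin 2) → ℂ => fun a k => x (a, k)) (by fun_prop)
  have hD1 : D (fun i => ρ i.1 i.2) = 1 := by
    simp only [D]
    rw [hS, LinearMap.toMatrix'_id, Matrix.det_one]
  refine hQ (eq_zero_of_eventually_eval_eq_zero (x := fun i => ρ i.1 i.2) ?_)
  filter_upwards [hD.continuousAt.eventually_ne (by rw [hD1]; exact one_ne_zero)] with x hx
  refine hcon (fun a k => x (a, k)) fun l => ?_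
  have hx' : IsUnit (LinearMap.toMatrix' (rigidityMap G (fun a k => x (a, k)) ∘ₗ S)) :=
    (Matrix.isUnit_iff_isUnit_det _).mpr (isUnit_iff_ne_zero.mpr hx)
  obtain ⟨w, hw⟩ := (Matrix.mulVec_surjective_iff_isUnit.mpr hx') l
  rw [LinearMap.toMatrix'_mulVec] at hw
  exact ⟨S w, hw⟩

end RigidityMap

/-! ### Henneberg moves preserve stress-freeness. -/

section Henneberg

variable {V : Type u}

theorem exists_dotProduct_eq {x y : Fin 2 → ℂ} (h : x 0 * y 1 - x 1 * y 0 ≠ 0) (α β : ℂ) :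
    ∃ p : Fin 2 → ℂ, x ⬝ᵥ p = α ∧ y ⬝ᵥ p = β := by
  refine ⟨![(α * y 1 - β * x 1) / (x 0 * y 1 - x 1 * y 0),
    (β * x 0 - α * y 0) / (x 0 * y 1 - x 1 * y 0)], ?_, ?_⟩
  · simp only [dotProduct, Fin.sum_univ_two, Matrix.cons_val_zero, Matrix.cons_val_one]
    rw [← mul_div_assoc, ← mul_div_assoc, ← add_div, div_eq_iff h]
    ring
  · simp only [dotProduct, Fin.sum_univ_two, Matrix.cons_val_zero, Matrix.cons_val_one]
    rw [← mul_div_assoc, ← mul_div_assoc, ← add_div, div_eq_iff h]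
    ring

theorem hennebergOne_adj_some_some {G : SimpleGraph V} {a b x y : V} :
    (hennebergOne G a b).Adj (some x) (some y) ↔ G.Adj x y := by
  rw [hennebergOne, SimpleGraph.sup_adj, SimpleGraph.map_adj, SimpleGraph.fromEdgeSet_adj]
  simp

theorem hennebergOne_adj_some_none {G : SimpleGraph V} {a b x : V} :
    (hennebergOne G a b).Adj (some x) none ↔ x = a ∨ x = b := by
  rw [hennebergOne, SimpleGraph.sup_adj, SimpleGraph.map_adj, SimpleGraph.fromEdgeSet_adj]
  simp

theorem hennebergTwo_adj_some_some {G : SimpleGraph V} {a b c x y : V} :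
    (hennebergTwo G a b c).Adj (some x) (some y) ↔ G.Adj x y ∧ s(x, y) ≠ s(a, b) := by
  rw [hennebergTwo, SimpleGraph.sup_adj, SimpleGraph.map_adj, SimpleGraph.fromEdgeSet_adj]
  simp

theorem hennebergTwo_adj_some_none {G : SimpleGraph V} {a b c x : V} :
    (hennebergTwo G a b c).Adj (some x) none ↔ x = a ∨ x = b ∨ x = c := by
  rw [hennebergTwo, SimpleGraph.sup_adj, SimpleGraph.map_adj, SimpleGraph.fromEdgeSet_adj]
  simp

theorem stressFree_option_of_forall {G : SimpleGraph (Option V)} {ρ : Realization V}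
    {t : Fin 2 → ℂ}
    (h : ∀ (y : V → V → ℂ) (z : V → ℂ), (∀ a b, y a b = y b a) →
      ∃ (p : Realization V) (q : Fin 2 → ℂ),
        (∀ a b, G.Adj (some a) (some b) → (ρ a - ρ b) ⬝ᵥ (p a - p b) = y a b) ∧
        ∀ a, G.Adj (some a) none → (t - ρ a) ⬝ᵥ (q - p a) = z a) :
    StressFree G fun o => o.elim t ρ := by
  rw [stressFree_iff]
  intro y hy
  obtain ⟨p, q, hp, hq⟩ := h (fun a b => y (some a) (some b)) (fun a => y none (some a))
    fun a b => hy _ _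
  refine ⟨fun o => o.elim q p, fun a b hab => ?_⟩
  cases a with
  | none =>
    cases b with
    | none => exact absurd hab (G.irrefl)
    | some b => exact hq b hab.symm
  | some a =>
    cases b with
    | none =>
      rw [hy, ← hq a hab]
      simp only [Option.elim]
      rw [← neg_sub t, ← neg_sub q, neg_dotProduct_neg]
    | some b => exact hp a b hab

/-- The new vertex is placed off the line ab, so its two edges give an invertible 2 × 2 system for
its velocity. -/
theorem StressFree.hennebergOne {G : SimpleGraph V} {ρ : Realization V} (h : StressFree G ρ)
    {a b : V} (hab : ρ a 0 ≠ ρ b 0) :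
    ∃ ρ', StressFree (hennebergOne G a b) ρ' := by
  refine ⟨fun o => o.elim (ρ a + ![0, 1]) ρ, stressFree_option_of_forall fun y z hy => ?_⟩
  obtain ⟨p, hp⟩ := stressFree_iff.mp h y hy
  obtain ⟨q, hqa, hqb⟩ := exists_dotProduct_eq (x := ρ a + ![0, 1] - ρ a)
    (y := ρ a + ![0, 1] - ρ b) (by
      simp only [add_sub_cancel_left, Pi.add_apply, Pi.sub_apply, Matrix.cons_val_zero,
        Matrix.cons_val_one]
      intro h0
      exact hab (by linear_combination -h0))
    (z a + (ρ a + ![0, 1] - ρ a) ⬝ᵥ p a) (z b + (ρ a + ![0, 1] - ρ b) ⬝ᵥ p b)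
  refine ⟨p, q, fun x x' hx => hp x x' (hennebergOne_adj_some_some.mp hx), fun x hx => ?_⟩
  rcases hennebergOne_adj_some_none.mp hx with rfl | rfl
  · rw [dotProduct_sub, hqa, add_sub_cancel_right]
  · rw [dotProduct_sub, hqb, add_sub_cancel_right]

/-- The new vertex t is placed on the line ab. Edges at and bt then both prescribe d · q; their
compatibility is a condition on d · (p b - p a), met by prescribing a value on the deleted edge ab.
Edge ct supplies the second equation for q. -/
theorem StressFree.hennebergTwo {G : SimpleGraph V} {ρ : Realization V} (h : StressFree G ρ)
    {a b c : V} (hadj : G.Adj a b) (hne : (ρ b 0 - ρ a 0) * (ρ c 1 - ρ a 1) -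
      (ρ b 1 - ρ a 1) * (ρ c 0 - ρ a 0) ≠ 0) :
    ∃ ρ', StressFree (hennebergTwo G a b c) ρ' := by
  classical
  set d := ρ b - ρ a with hd
  set t := ρ b + d with ht
  refine ⟨fun o => o.elim t ρ, stressFree_option_of_forall fun y z hy => ?_⟩
  obtain ⟨p, hp⟩ := stressFree_iff.mp h
    -- Since t - a = 2d and t - b = d, compatibility reads d · (p b - p a) = z a / 2 - z b.
    (fun x x' => if s(x, x') = s(a, b) then z a / 2 - z b else y x x')
    fun x x' => by simp only [hy x x', Sym2.eq_swap]
  obtain ⟨q, hqb, hqc⟩ := exists_dotProduct_eq (x := d) (y := t - ρ c) (by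
    simp only [ht, hd, Pi.add_apply, Pi.sub_apply]
    contrapose! hne
    linear_combination -hne) (z b + d ⬝ᵥ p b) (z c + (t - ρ c) ⬝ᵥ p c)
  refine ⟨p, q, fun x x' hx => ?_, fun x hx => ?_⟩
  · obtain ⟨hx1, hx2⟩ := hennebergTwo_adj_some_some.mp hx
    rw [hp x x' hx1, if_neg hx2]
  · have hta : t - ρ a = (2 : ℂ) • d := by
      rw [ht, hd, two_smul]
      abel
    have htb : t - ρ b = d := by
      rw [ht]
      abel
    have hpab : d ⬝ᵥ p a - d ⬝ᵥ p b = z b - z a / 2 := by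
      have := hp a b hadj
      rw [if_pos rfl, ← neg_sub (ρ b), ← hd, neg_dotProduct, dotProduct_sub] at this
      linear_combination -this
    rcases hennebergTwo_adj_some_none.mp hx with rfl | rfl | rfl
    · rw [hta, smul_dotProduct, dotProduct_sub, hqb, smul_eq_mul]
      linear_combination -2 * hpab
    · rw [htb, dotProduct_sub, hqb, add_sub_cancel_right]
    · rw [dotProduct_sub, hqc, add_sub_cancel_right]

theorem StressFree.map_iso {W : Type u} {G : SimpleGraph V} {H : SimpleGraph W} (e : G ≃g H)
    {ρ : Realization V} (h : StressFree G ρ) : StressFree H (ρ ∘ e.symm) := by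
  rw [stressFree_iff]
  intro y hy
  obtain ⟨p, hp⟩ := stressFree_iff.mp h (fun a b => y (e a) (e b)) fun a b => hy _ _
  refine ⟨p ∘ e.symm, fun a b hab => ?_⟩
  have := hp (e.symm a) (e.symm b) (e.symm.map_adj_iff.mpr hab)
  simpa using this

theorem exists_stressFree_of_iso_top {G : SimpleGraph V} (e : G ≃g (⊤ : SimpleGraph (Fin 2))) :
    ∃ ρ, StressFree G ρ := by
  refine ⟨fun w => if e w = 0 then 0 else ![1, 0], ?_⟩
  rw [stressFree_iff]
  intro y hy
  refine ⟨fun w => if e w = 0 then 0 else ![y (e.symm 0) (e.symm 1), 0], fun a b hab => ?_⟩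
  have hne : e a ≠ e b := e.map_adj_iff.mpr hab
  obtain ⟨i, rfl⟩ := e.symm.surjective a
  obtain ⟨j, rfl⟩ := e.symm.surjective b
  simp only [RelIso.apply_symm_apply] at hne ⊢
  fin_cases i <;> fin_cases j <;> simp_all

theorem disjoint_image_sym2Map_some (S : Set (Sym2 V)) {T : Set (Sym2 (Option V))}
    (hT : ∀ e ∈ T, none ∈ e) : Disjoint (Function.Embedding.some.sym2Map '' S) T := by
  rw [Set.disjoint_left]
  rintro _ ⟨e, -, rfl⟩ he
  simpa using hT _ he

theorem ncard_edgeSet_hennebergOne [Finite V] (G : SimpleGraph V) {a b : V} (hab : a ≠ b) :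
    (hennebergOne G a b).edgeSet.ncard = G.edgeSet.ncard + 2 := by
  have hdiag : ({s(some a, none), s(some b, none)} : Set (Sym2 (Option V))) \ Sym2.diagSet =
      {s(some a, none), s(some b, none)} := by
    rw [sdiff_eq_left, Set.disjoint_left]
    rintro e (rfl | rfl) <;> simp
  rw [hennebergOne, SimpleGraph.edgeSet_sup, SimpleGraph.edgeSet_map,
    SimpleGraph.edgeSet_fromEdgeSet, hdiag, Set.ncard_union_eq,
    Set.ncard_image_of_injective _ (Function.Embedding.injective _), Set.ncard_pair]
  · simpa using hab
  · refine disjoint_image_sym2Map_some _ ?_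
    rintro e (rfl | rfl) <;> simp

theorem ncard_edgeSet_hennebergTwo [Finite V] (G : SimpleGraph V) {a b c : V} (hab : G.Adj a b)
    (hca : c ≠ a) (hcb : c ≠ b) :
    (hennebergTwo G a b c).edgeSet.ncard = G.edgeSet.ncard + 2 := by
  have hdiag : ({s(some a, none), s(some b, none), s(some c, none)} : Set (Sym2 (Option V))) \
      Sym2.diagSet = {s(some a, none), s(some b, none), s(some c, none)} := by
    rw [sdiff_eq_left, Set.disjoint_left]
    rintro e (rfl | rfl | rfl) <;> simp
  have hthree : ({s(some a, none), s(some b, none), s(some c, none)} :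
      Set (Sym2 (Option V))).ncard = 3 := by
    refine Set.ncard_eq_three.mpr ⟨_, _, _, ?_, ?_, ?_, rfl⟩
    · simpa using hab.ne
    · simpa using hca.symm
    · simpa using hcb.symm
  rw [hennebergTwo, SimpleGraph.edgeSet_sup, SimpleGraph.edgeSet_map,
    SimpleGraph.edgeSet_fromEdgeSet, hdiag, Set.ncard_union_eq, hthree,
    Set.ncard_image_of_injective _ (Function.Embedding.injective _),
    SimpleGraph.edgeSet_deleteEdges,
    ← Set.ncard_sdiff_singleton_add_one (s := G.edgeSet) (a := s(a, b)) hab]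
  refine disjoint_image_sym2Map_some _ ?_
  rintro e (rfl | rfl | rfl) <;> simp

theorem HennebergConstructible.exists_stressFree {V : Type u} {G : SimpleGraph V}
    (h : HennebergConstructible G) : Finite V ∧
      (G.edgeSet.ncard : ℤ) = 2 * (Nat.card V : ℤ) - 3 ∧ ∃ ρ, StressFree G ρ := by
  induction h with
  | @edge V G e =>
    refine ⟨Finite.of_equiv _ e.symm.toEquiv, ?_, exists_stressFree_of_iso_top e⟩
    rw [Nat.card_congr e.toEquiv, ← Nat.card_coe_set_eq, Nat.card_congr e.mapEdgeSet]
    rw [Nat.card_eq_fintype_card, ← SimpleGraph.edgeFinset_card,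
      SimpleGraph.card_edgeFinset_top_eq_card_choose_two]
    simp
  | @iso V W G H e hG ih =>
    obtain ⟨hfin, hcard, ρ, hρ⟩ := ih
    refine ⟨Finite.of_equiv _ e.toEquiv, ?_, _, hρ.map_iso e⟩
    rw [← Nat.card_congr e.toEquiv, ← hcard, ← Nat.card_coe_set_eq, ← Nat.card_coe_set_eq,
      Nat.card_congr e.mapEdgeSet]
  | @one V G hG a b hab ih =>
    obtain ⟨hfin, hcard, ρ, hρ⟩ := ih
    have hQ : (X (a, 0) - X (b, 0) : MvPolynomial (V × Fin 2) ℂ) ≠ 0 := by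
      rw [sub_ne_zero]
      exact fun h => hab (by simpa using X_injective h)
    obtain ⟨ρ', hρ', hne⟩ := hρ.exists_eval_ne_zero hQ
    refine ⟨inferInstance, ?_, hρ'.hennebergOne (by simpa [sub_eq_zero] using hne)⟩
    rw [ncard_edgeSet_hennebergOne G hab, Finite.card_option]
    push_cast
    omega
  | @two V G hG a b c hab hca hcb ih =>
    classical
    obtain ⟨hfin, hcard, ρ, hρ⟩ := ih
    have hQ : ((X (b, 0) - X (a, 0)) * (X (c, 1) - X (a, 1)) -
        (X (b, 1) - X (a, 1)) * (X (c, 0) - X (a, 0)) : MvPolynomial (V × Fin 2) ℂ) ≠ 0 := by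
      intro h
      -- Test point: a = (0, 0), b = (1, 0), c = (0, 1), where the collinearity determinant is 1.
      have := congrArg (eval fun i => if i = (b, 0) ∨ i = (c, 1) then 1 else 0) h
      simp [hab.ne, hca.symm, hcb, hcb.symm] at this
    obtain ⟨ρ', hρ', hne⟩ := hρ.exists_eval_ne_zero hQ
    refine ⟨inferInstance, ?_, hρ'.hennebergTwo hab (by simpa using hne)⟩
    rw [ncard_edgeSet_hennebergTwo G hab hca hcb, Finite.card_option]
    push_cast
    omega

theorem HennebergConstructible.genericallyRigid {G : SimpleGraph V}
    (h : HennebergConstructible G) (hne : ∃ u v, G.Adj u v) : GenericallyRigid G := by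
  obtain ⟨hfin, hcard, ρ, hρ⟩ := h.exists_stressFree
  obtain ⟨u, v, huv⟩ := hne
  exact hρ.lengthsIndependent.genericallyRigid huv hcard

end Henneberg

/-! ### Counting edges spanned by vertex sets. -/

section Counting

open Classical in
/-- The number of ordered pairs of adjacent vertices in `X`, i.e. twice the number of edges spanned
by `X`. -/
noncomputable def pairCount {V : Type*} (G : SimpleGraph V) (X : Finset V) : ℤ :=
  ∑ a ∈ X, ∑ b ∈ X, if G.Adj a b then 1 else 0

/-- The counting form of the Laman condition. -/
def LamanCount {V : Type*} [Fintype V] (G : SimpleGraph V) : Prop :=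
  pairCount G Finset.univ = 4 * (Fintype.card V : ℤ) - 6 ∧
  ∀ X : Finset V, 2 ≤ X.card → pairCount G X ≤ 4 * (X.card : ℤ) - 6

variable {V : Type*} (G : SimpleGraph V)

open Classical in
theorem pairCount_eq_sum_univ [Fintype V] (X : Finset V) :
    pairCount G X = ∑ a, ∑ b, if a ∈ X ∧ b ∈ X ∧ G.Adj a b then 1 else 0 := by
  simp only [pairCount, ite_and, Finset.sum_ite_mem, Finset.univ_inter, Finset.sum_ite_irrel,
    Finset.sum_const_zero]

theorem pairCount_univ_eq_two_mul [Fintype V] :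
    pairCount G Finset.univ = 2 * (G.edgeSet.ncard : ℤ) := by
  classical
  have h := G.sum_degrees_eq_twice_card_edges
  rw [← SimpleGraph.coe_edgeFinset, Set.ncard_coe_finset]
  have h2 : ((∑ v, G.degree v : ℕ) : ℤ) = 2 * (G.edgeFinset.card : ℤ) := by exact_mod_cast h
  rw [← h2, pairCount]
  push_cast
  refine Finset.sum_congr rfl fun a _ => ?_
  rw [SimpleGraph.degree, SimpleGraph.neighborFinset_eq_filter, Finset.card_filter]
  push_cast
  rfl

theorem pairCount_eq_two_mul [Fintype V] (X : Finset V) :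
    pairCount G X = 2 * (((⊤ : G.Subgraph).induce (X : Set V)).edgeSet.ncard : ℤ) := by
  classical
  rw [← SimpleGraph.Subgraph.edgeSet_spanningCoe, ← pairCount_univ_eq_two_mul,
    pairCount_eq_sum_univ, pairCount]
  simp

theorem IsLaman.lamanCount [Fintype V] {G : SimpleGraph V} (h : IsLaman G) : LamanCount G := by
  constructor
  · rw [pairCount_univ_eq_two_mul, h.1, Nat.card_eq_fintype_card]
    ring
  · intro X hX
    have := h.2 ((⊤ : G.Subgraph).induce (X : Set V)) (by simpa using hX)
    rw [SimpleGraph.Subgraph.induce_verts, Set.ncard_coe_finset] at this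
    rw [pairCount_eq_two_mul]
    linarith

theorem pairCount_supermodular [Fintype V] [DecidableEq V] (X Y : Finset V) :
    pairCount G X + pairCount G Y ≤ pairCount G (X ∪ Y) + pairCount G (X ∩ Y) := by
  classical
  simp only [pairCount_eq_sum_univ, ← Finset.sum_add_distrib]
  refine Finset.sum_le_sum fun a _ => Finset.sum_le_sum fun b _ => ?_
  simp only [Finset.mem_union, Finset.mem_inter]
  by_cases h1 : a ∈ X <;> by_cases h2 : a ∈ Y <;> by_cases h3 : b ∈ X <;> by_cases h4 : b ∈ Y <;>
    simp [h1, h2, h3, h4] <;> split_ifs <;> simp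

theorem ite_add_ite_add_ite_le {p q r t : Prop} [Decidable p] [Decidable q] [Decidable r]
    [Decidable t] (hpq : ¬ (p ∧ q)) (hpr : ¬ (p ∧ r)) (hqr : ¬ (q ∧ r)) (ht : p ∨ q ∨ r → t) :
    (if p then (1 : ℤ) else 0) + (if q then 1 else 0) + (if r then 1 else 0) ≤
      if t then 1 else 0 := by
  split_ifs <;> first | (exfalso; tauto) | norm_num

/-- Sets sharing at most one vertex share no edge. -/
theorem pairCount_add_add_le [Fintype V] [DecidableEq V] {X Y Z : Finset V}
    (hXY : (X ∩ Y).card ≤ 1) (hXZ : (X ∩ Z).card ≤ 1) (hYZ : (Y ∩ Z).card ≤ 1) :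
    pairCount G X + pairCount G Y + pairCount G Z ≤ pairCount G (X ∪ Y ∪ Z) := by
  classical
  simp only [pairCount_eq_sum_univ, ← Finset.sum_add_distrib]
  refine Finset.sum_le_sum fun a _ => Finset.sum_le_sum fun b _ => ?_
  by_cases hab : G.Adj a b
  · have key {S T : Finset V} (h : (S ∩ T).card ≤ 1) (ha : a ∈ S) (ha' : a ∈ T) (hb : b ∈ S)
        (hb' : b ∈ T) : False :=
      hab.ne (Finset.card_le_one.mp h a (Finset.mem_inter.mpr ⟨ha, ha'⟩) b
        (Finset.mem_inter.mpr ⟨hb, hb'⟩))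
    have h1 : ¬ ((a ∈ X ∧ b ∈ X) ∧ (a ∈ Y ∧ b ∈ Y)) :=
      fun h => key hXY h.1.1 h.2.1 h.1.2 h.2.2
    have h2 : ¬ ((a ∈ X ∧ b ∈ X) ∧ (a ∈ Z ∧ b ∈ Z)) :=
      fun h => key hXZ h.1.1 h.2.1 h.1.2 h.2.2
    have h3 : ¬ ((a ∈ Y ∧ b ∈ Y) ∧ (a ∈ Z ∧ b ∈ Z)) :=
      fun h => key hYZ h.1.1 h.2.1 h.1.2 h.2.2
    have h4 : (a ∈ X ∧ b ∈ X) ∨ (a ∈ Y ∧ b ∈ Y) ∨ (a ∈ Z ∧ b ∈ Z) →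
        a ∈ X ∪ Y ∪ Z ∧ b ∈ X ∪ Y ∪ Z := by
      simp only [Finset.mem_union]
      tauto
    simp only [hab, and_true]
    exact ite_add_ite_add_ite_le h1 h2 h3 h4
  · simp [hab]

theorem pairCount_insert [Fintype V] [DecidableEq V] [inst : DecidableRel G.Adj] {X : Finset V} {v : V}
    (hv : v ∉ X) :
    pairCount G (insert v X) = pairCount G X + 2 * ((G.neighborFinset v ∩ X).card : ℤ) := by
  classical
  obtain rfl : inst = fun _ _ => Classical.propDecidable _ := Subsingleton.elim _ _
  have h1 : ((G.neighborFinset v ∩ X).card : ℤ) = ∑ b ∈ X, if G.Adj v b then 1 else 0 := by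
    rw [Finset.inter_comm, ← Finset.filter_mem_eq_inter, Finset.card_filter]
    simp
  rw [h1]
  simp only [pairCount, Finset.sum_insert hv, Finset.sum_add_distrib, SimpleGraph.irrefl,
    G.adj_comm _ v, if_false, zero_add]
  ring

theorem pairCount_map {W : Type*} (f : W ↪ V) (X : Finset W) :
    pairCount (G.comap f) X = pairCount G (X.map f) := by
  simp only [pairCount, Finset.sum_map]
  rfl

theorem pairCount_sup_edge [DecidableEq V] {x y : V} (hxy : x ≠ y) (hadj : ¬ G.Adj x y)
    (X : Finset V) :
    pairCount (G ⊔ SimpleGraph.edge x y) X =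
      pairCount G X + if x ∈ X ∧ y ∈ X then 2 else 0 := by
  classical
  have h (a b : V) [Decidable ((G ⊔ SimpleGraph.edge x y).Adj a b)] : (if (G ⊔ SimpleGraph.edge x y).Adj a b then (1 : ℤ) else 0) =
      (if G.Adj a b then 1 else 0) + (if a = x then if b = y then 1 else 0 else 0) +
        (if a = y then if b = x then 1 else 0 else 0) := by
    have hadj' : ¬ G.Adj y x := fun h => hadj h.symm
    simp only [SimpleGraph.sup_adj, SimpleGraph.edge_adj]
    by_cases h1 : a = x
    · subst h1
      by_cases h2 : b = y
      · subst h2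
        simp [hxy, hadj]
      · simp [h2, hxy]
    · by_cases h2 : a = y
      · subst h2
        by_cases h3 : b = x
        · subst h3
          simp [hxy.symm, hadj']
        · simp [h3, hxy.symm]
      · simp [h1, h2]
  simp only [pairCount, h, Finset.sum_add_distrib]
  simp only [Finset.sum_ite_irrel, Finset.sum_ite_eq', Finset.sum_const_zero]
  by_cases h1 : x ∈ X <;> by_cases h2 : y ∈ X <;> simp [h1, h2]
  ring

/-- If x and y are adjacent, {x, y} is itself tight: 2 = 4 · 2 - 6. Adjacent pairs are thus blocked
in the same way as pairs inside a larger tight set. -/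
theorem exists_tight_of_not_adj_imp [DecidableEq V] {v x y : V} (hxv : x ≠ v) (hyv : y ≠ v) (hxy : x ≠ y)
    (hcon : ¬ G.Adj x y → ∃ X : Finset V, v ∉ X ∧ x ∈ X ∧ y ∈ X ∧
      4 * (X.card : ℤ) - 6 ≤ pairCount G X) :
    ∃ X : Finset V, v ∉ X ∧ x ∈ X ∧ y ∈ X ∧ 4 * (X.card : ℤ) - 6 ≤ pairCount G X := by
  by_cases hadj : G.Adj x y
  · refine ⟨{x, y}, by simp [hxv.symm, hyv.symm], by simp, by simp, ?_⟩
    simp [pairCount, Finset.sum_pair hxy, hadj, hadj.symm, Finset.card_pair hxy]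
  · exact hcon hadj

end Counting

/-! ### Low-degree vertices and reducible pairs. -/

section Reduction

variable {V : Type*} [Fintype V] {G : SimpleGraph V}

theorem LamanCount.two_le_degree [DecidableRel G.Adj] (h : LamanCount G)
    (hcard : 3 ≤ Fintype.card V) (v : V) : 2 ≤ G.degree v := by
  classical
  have h1 := pairCount_insert G (Finset.notMem_erase v Finset.univ)
  have h2 : G.neighborFinset v ∩ Finset.univ.erase v = G.neighborFinset v := by
    rw [Finset.inter_eq_left]
    intro w hw
    simpa using ((G.mem_neighborFinset v w).mp hw).ne'
  have h3 := h.2 (Finset.univ.erase v)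
  rw [Finset.card_erase_of_mem (Finset.mem_univ v), Finset.card_univ] at h3
  rw [Finset.insert_erase (Finset.mem_univ v), h.1, h2, SimpleGraph.card_neighborFinset_eq_degree]
    at h1
  have h4 := h3 (by omega)
  omega

theorem LamanCount.exists_degree_le_three [DecidableRel G.Adj] (h : LamanCount G) :
    ∃ v, G.degree v ≤ 3 := by
  classical
  by_contra! hcon
  have h1 : Fintype.card V * 4 ≤ ∑ v, G.degree v := by
    rw [← smul_eq_mul, ← Finset.card_univ]
    exact Finset.card_nsmul_le_sum _ _ _ fun v _ => hcon v
  rw [G.sum_degrees_eq_twice_card_edges] at h1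
  have h2 := h.1
  rw [pairCount_univ_eq_two_mul, ← SimpleGraph.coe_edgeFinset, Set.ncard_coe_finset] at h2
  omega

/-- Adding v raises the pair count by 6 but the bound only by 4. -/
theorem LamanCount.not_tight_of_neighborFinset_subset [DecidableEq V] [DecidableRel G.Adj]
    (h : LamanCount G) {v : V} (hdeg : G.degree v = 3) {X : Finset V} (hv : v ∉ X)
    (hX : G.neighborFinset v ⊆ X) : pairCount G X < 4 * (X.card : ℤ) - 6 := by
  have h1 := pairCount_insert G hv
  rw [Finset.inter_eq_left.mpr hX, SimpleGraph.card_neighborFinset_eq_degree, hdeg] at h1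
  have h3 := Finset.card_le_card hX
  rw [SimpleGraph.card_neighborFinset_eq_degree, hdeg] at h3
  have h2 := h.2 (insert v X)
  rw [Finset.card_insert_of_notMem hv] at h2
  have h4 := h2 (by omega)
  push_cast at h4 h1
  linarith

/-- With two common vertices, supermodularity would make X ∪ Y tight although it contains all
neighbours of v. -/
theorem LamanCount.card_inter_le_one [DecidableEq V] [DecidableRel G.Adj] (h : LamanCount G)
    {v : V} (hdeg : G.degree v = 3) {X Y : Finset V} (hvX : v ∉ X) (hvY : v ∉ Y)
    (hX : 4 * (X.card : ℤ) - 6 ≤ pairCount G X) (hY : 4 * (Y.card : ℤ) - 6 ≤ pairCount G Y)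
    (hsub : G.neighborFinset v ⊆ X ∪ Y) : (X ∩ Y).card ≤ 1 := by
  by_contra! hlt
  have h1 := h.2 (X ∩ Y) hlt
  have h2 := pairCount_supermodular G X Y
  have h3 := h.not_tight_of_neighborFinset_subset hdeg (by simp [hvX, hvY]) hsub
  have h4 := Finset.card_union_add_card_inter X Y
  omega

/-- If all three pairs of neighbours were blocked, the tight sets X, Y, Z would pairwise share at
most one vertex. Their union U has |U| ≤ |X| + |Y| + |Z| - 3 and pair count at least 4(|X| + |Y| +
|Z|) - 18 ≥ 4|U| - 6, so it is tight and contains all neighbours of v, a contradiction. -/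
theorem LamanCount.exists_reducible_pair [DecidableEq V] [DecidableRel G.Adj] (h : LamanCount G)
    {v : V} (hdeg : G.degree v = 3) :
    ∃ x y z : V, x ≠ y ∧ z ≠ x ∧ z ≠ y ∧ G.neighborFinset v = {x, y, z} ∧ ¬ G.Adj x y ∧
      ∀ X : Finset V, v ∉ X → x ∈ X → y ∈ X → pairCount G X < 4 * (X.card : ℤ) - 6 := by
  rw [← SimpleGraph.card_neighborFinset_eq_degree] at hdeg
  obtain ⟨a, b, c, hab, hac, hbc, hN⟩ := Finset.card_eq_three.mp hdeg
  rw [SimpleGraph.card_neighborFinset_eq_degree] at hdeg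
  by_contra! hcon
  have hav : a ≠ v := ((G.mem_neighborFinset v a).mp (by simp [hN])).ne'
  have hbv : b ≠ v := ((G.mem_neighborFinset v b).mp (by simp [hN])).ne'
  have hcv : c ≠ v := ((G.mem_neighborFinset v c).mp (by simp [hN])).ne'
  obtain ⟨X, hvX, haX, hbX, hX⟩ := exists_tight_of_not_adj_imp G hav hbv hab
    (hcon a b c hab hac.symm hbc.symm hN)
  obtain ⟨Y, hvY, hbY, hcY, hY⟩ := exists_tight_of_not_adj_imp G hbv hcv hbc
    (hcon b c a hbc hab hac (by rw [hN]; ext; simp; tauto))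
  obtain ⟨Z, hvZ, haZ, hcZ, hZ⟩ := exists_tight_of_not_adj_imp G hav hcv hac
    (hcon a c b hac hab.symm hbc (by rw [hN]; ext; simp; tauto))
  have hXY := h.card_inter_le_one hdeg hvX hvY hX hY (by simp [Finset.insert_subset_iff, *])
  have hXZ := h.card_inter_le_one hdeg hvX hvZ hX hZ (by simp [Finset.insert_subset_iff, *])
  have hYZ := h.card_inter_le_one hdeg hvY hvZ hY hZ (by simp [Finset.insert_subset_iff, *])
  have h1 := pairCount_add_add_le G hXY hXZ hYZ
  have h2 := h.not_tight_of_neighborFinset_subset hdeg (X := X ∪ Y ∪ Z) (by simp [*])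
    (by simp [Finset.insert_subset_iff, *])
  have h3 := Finset.card_union_add_card_inter X Y
  have h4 := Finset.card_union_add_card_inter (X ∪ Y) Z
  have h5 : 1 ≤ (X ∩ Y).card := Finset.card_pos.mpr ⟨b, by simp [*]⟩
  have h6 : 2 ≤ ((X ∪ Y) ∩ Z).card := by
    rw [← Finset.card_pair hac]
    exact Finset.card_le_card (by simp [Finset.insert_subset_iff, *])
  omega

end Reduction

/-! ### Building Laman graphs by induction on the number of vertices. -/

section Construction

variable {V : Type u} [Fintype V] {G : SimpleGraph V}

/-- Adding a vertex to a graph on the complement of `v` recovers the graph. -/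
def isoOfOption [DecidableEq V] (v : V) (H : SimpleGraph (Option {w // w ≠ v}))
    (hsome : ∀ x y : {w // w ≠ v}, H.Adj (some x) (some y) ↔ G.Adj x y)
    (hnone : ∀ x : {w // w ≠ v}, H.Adj (some x) none ↔ G.Adj v x) : H ≃g G where
  toEquiv := Equiv.optionSubtypeNe v
  map_rel_iff' := by
    rintro (_ | x) (_ | y)
    · simp
    · simp [H.adj_comm none, hnone]
    · simp [hnone, G.adj_comm v]
    · simp [hsome]

theorem LamanCount.iso_top (h : LamanCount G) (hcard : Fintype.card V = 2) :
    Nonempty (G ≃g (⊤ : SimpleGraph (Fin 2))) := by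
  classical
  refine ⟨⟨Fintype.equivFinOfCardEq hcard, fun {x y} => ?_⟩⟩
  simp only [SimpleGraph.top_adj, ne_eq, EmbeddingLike.apply_eq_iff_eq]
  refine ⟨fun hxy => ?_, fun hxy => hxy.ne⟩
  by_contra hadj
  have huniv : ({x, y} : Finset V) = Finset.univ :=
    Finset.eq_univ_of_card _ (by rw [Finset.card_pair hxy, hcard])
  have h1 := h.1
  have hadj' : ¬ G.Adj y x := fun h => hadj h.symm
  rw [← huniv, hcard] at h1
  simp [pairCount, Finset.sum_pair hxy, hadj, hadj'] at h1

theorem LamanCount.hennebergConstructible (n : ℕ) : ∀ {V : Type u} [Fintype V]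
    {G : SimpleGraph V}, LamanCount G → Fintype.card V = n + 2 → HennebergConstructible G := by
  classical
  induction n with
  | zero =>
    intro V _ G h hcard
    exact .edge (h.iso_top hcard).some
  | succ n ih =>
    intro V _ G h hcard
    obtain ⟨v, hv⟩ := h.exists_degree_le_three
    have hv2 := h.two_le_degree (by omega) v
    let f : {w // w ≠ v} ↪ V := Function.Embedding.subtype _
    have hcardW : Fintype.card {w // w ≠ v} = n + 2 := by
      rw [Fintype.card_subtype_compl, Fintype.card_subtype_eq, hcard]
      omega
    have hmem (X : Finset {w // w ≠ v}) : v ∉ X.map f := by simp [f]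
    have huniv : pairCount G Finset.univ =
        pairCount (G.comap f) Finset.univ + 2 * (G.degree v : ℤ) := by
      have huniv : insert v ((Finset.univ : Finset {w // w ≠ v}).map f) = Finset.univ := by
        ext w
        by_cases hw : w = v <;> simp [f, hw]
      rw [pairCount_map, ← huniv, pairCount_insert G (hmem _),
        ← SimpleGraph.card_neighborFinset_eq_degree, Finset.inter_eq_left.mpr]
      intro w hw
      simpa [f] using ((G.mem_neighborFinset v w).mp hw).ne'
    rw [h.1, hcard] at huniv
    have hsub (X : Finset {w // w ≠ v}) (hX : 2 ≤ X.card) :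
        pairCount (G.comap f) X ≤ 4 * (X.card : ℤ) - 6 := by
      rw [pairCount_map, ← Finset.card_map f]
      exact h.2 _ (by rwa [Finset.card_map])
    obtain hdeg | hdeg : G.degree v = 2 ∨ G.degree v = 3 := by omega
    · have hL : LamanCount (G.comap f) := by
        refine ⟨?_, hsub⟩
        rw [hcardW]
        rw [hdeg] at huniv
        push_cast at huniv ⊢
        linarith
      rw [← SimpleGraph.card_neighborFinset_eq_degree, Finset.card_eq_two] at hdeg
      obtain ⟨a, b, hab, hN⟩ := hdeg
      have hadj (w : V) : G.Adj v w ↔ w = a ∨ w = b := by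
        rw [← SimpleGraph.mem_neighborFinset, hN]
        simp
      have ha : a ≠ v := ((hadj a).mpr (.inl rfl)).ne'
      have hb : b ≠ v := ((hadj b).mpr (.inr rfl)).ne'
      refine .iso (isoOfOption v _ ?_ ?_) (.one (ih hL hcardW) ⟨a, ha⟩ ⟨b, hb⟩ (by simpa using hab))
      · intro x y
        rw [hennebergOne_adj_some_some]
        rfl
      · intro x
        rw [hennebergOne_adj_some_none, hadj, Subtype.ext_iff, Subtype.ext_iff]
    · obtain ⟨a, b, c, hab, hca, hcb, hN, hnadj, htight⟩ := h.exists_reducible_pair hdeg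
      have hadj (w : V) : G.Adj v w ↔ w = a ∨ w = b ∨ w = c := by
        rw [← SimpleGraph.mem_neighborFinset, hN]
        simp
      have ha : a ≠ v := ((hadj a).mpr (.inl rfl)).ne'
      have hb : b ≠ v := ((hadj b).mpr (.inr (.inl rfl))).ne'
      have hc : c ≠ v := ((hadj c).mpr (.inr (.inr rfl))).ne'
      have hab' : (⟨a, ha⟩ : {w // w ≠ v}) ≠ ⟨b, hb⟩ := by simpa using hab
      have hnadj' : ¬ (G.comap f).Adj ⟨a, ha⟩ ⟨b, hb⟩ := hnadj
      have hL : LamanCount (G.comap f ⊔ SimpleGraph.edge ⟨a, ha⟩ ⟨b, hb⟩) := by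
        refine ⟨?_, fun X hX => ?_⟩
        · rw [pairCount_sup_edge _ hab' hnadj', hcardW, if_pos (by simp)]
          rw [hdeg] at huniv
          push_cast at huniv ⊢
          linarith
        · rw [pairCount_sup_edge _ hab' hnadj']
          split_ifs with hmem'
          · have h1 := htight (X.map f) (hmem X) (Finset.mem_map_of_mem f hmem'.1)
              (Finset.mem_map_of_mem f hmem'.2)
            rw [← pairCount_map, Finset.card_map] at h1
            -- Pair counts are even, so the strict inequality leaves room for the 2 contributed by
            -- the new edge.
            have h2 := pairCount_eq_two_mul (G.comap f) X
            omega
          · rw [add_zero]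
            exact hsub X hX
      refine .iso (isoOfOption v _ ?_ ?_) (.two (ih hL hcardW) ⟨a, ha⟩ ⟨b, hb⟩ ⟨c, hc⟩
        (by simp [SimpleGraph.edge_adj, hab]) (by simpa using hca) (by simpa using hcb))
      · intro x y
        rw [hennebergTwo_adj_some_some, SimpleGraph.sup_adj, SimpleGraph.edge_adj]
        have h1 : (G.comap f).Adj x y → s(x, y) ≠ s(⟨a, ha⟩, ⟨b, hb⟩) := by
          intro h1 h2
          rw [← SimpleGraph.mem_edgeSet, h2] at h1
          exact hnadj' h1
        have h2 : (G.comap f).Adj x y ↔ G.Adj x y := Iff.rfl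
        rw [← h2]
        simp only [ne_eq, Sym2.eq_iff] at h1 ⊢
        tauto
      · intro x
        rw [hennebergTwo_adj_some_none, hadj, Subtype.ext_iff, Subtype.ext_iff, Subtype.ext_iff]

theorem IsLaman.hennebergConstructible {V : Type u} [Finite V] {G : SimpleGraph V}
    (h : IsLaman G) (hcard : 2 ≤ Nat.card V) : HennebergConstructible G := by
  have := Fintype.ofFinite V
  rw [Nat.card_eq_fintype_card] at hcard
  exact h.lamanCount.hennebergConstructible (Fintype.card V - 2) (by omega)

end Construction

end LamanRigidity

theorem theorem1p7 {V : Type*} [Finite V] (G : SimpleGraph V) (hconn : G.Connected)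
    (hcard : 2 ≤ Nat.card V) :
    List.TFAE [LamanRigidity.IsLaman G, LamanRigidity.GenericallyRigid G,
      LamanRigidity.HennebergConstructible G] := by
  have : Nontrivial V := Finite.one_lt_card_iff_nontrivial.mp hcard
  -- Connectedness enters only here, to provide an edge to pin.
  have hne : ∃ u v, G.Adj u v := by
    obtain ⟨u, w, huw⟩ := exists_pair_ne V
    obtain ⟨p⟩ := hconn.preconnected u w
    cases p with
    | nil => exact absurd rfl huw
    | cons h _ => exact ⟨_, _, h⟩
  tfae_have 1 → 3 := fun h => h.hennebergConstructible hcard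
  tfae_have 3 → 2 := fun h => h.genericallyRigid hne
  tfae_have 2 → 1 := fun h => h.isLaman hne
  tfae_finish
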